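/- Let $\mathcal A$ be a finite indexed collection of $n$ distinct linear hyperplanes in $\mathbb R^d$, each with a chosen positive side, that is centrally simple: for $0\le k\le d$, any $k$ of the hyperplanes intersect in a subspace of dimension $d-k$. For a central arrangement $\mathcal B$ let $\mathcal T(\mathcal B)$ be the set of its topes, that is, the connected components of the complement of the union of its hyperplanes. The odd-even invariant of $\mathcal B$ is $$\Bigl|\sum_{T\in\mathcal T(\mathcal B)}(-1)^{\sigma(T)}\Bigr|,$$ where $\sigma(T)$ is the number of hyperplanes of $\mathcal B$ whose open positive side contains $T$. The tope graph of $\mathcal B$ has vertex set $\mathcal T(\mathcal B)$, two distinct topes being adjacent if the intersection of their closures is a facet of each. For $H\in\mathcal A$ let $\mathcal A\setminus\{H\}$ be the arrangement in $\mathbb R^d$ with $H$ deleted, and let $\mathcal A/\{H\}$ be the arrangement in the $(d-1)$-dimensional space $H$ formed by the intersections $H'\cap H$ with $H'\in\mathcal A\setminus\{H\}$, indexed by $\mathcal A\setminus\{H\}$. Suppose that $\mathcal A$ includes a hyperplane $H$ such that the odd-even invariant of $\mathcal A\setminus\{H\}$ is greater than $2\,|\mathcal T(\mathcal A/\{H\})|$.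 Then the tope graph of $\mathcal A$ has no perfect matching. -/

import Mathlib

/-- A central arrangement of hyperplanes, indexed by `ι`, in the real vector space `V`, with a
positive and a negative side specified for every hyperplane. The `i`-th hyperplane is the kernel
of the nonzero linear form `form i`, and its positive side is where that form is positive. -/
structure CentralArrangement (ι V : Type*) [AddCommGroup V] [Module ℝ V] where
  /-- The linear form whose kernel is the `i`-th hyperplane. -/
  form : ι → Module.Dual ℝ V
  form_ne_zero : ∀ i, form i ≠ 0

/-- `F` is a facet of the (full-dimensional) closed convex polyhedron `P`: a nonempty face of `P`,
cut out by a supporting linear form, whose affine span has codimension one. -/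
def IsPolyhedronFacet {V : Type*} [NormedAddCommGroup V] [NormedSpace ℝ V] (P F : Set V) : Prop :=
  F.Nonempty ∧ IsExposed ℝ P F ∧
    Module.finrank ℝ (vectorSpan ℝ F) + 1 = Module.finrank ℝ V

namespace CentralArrangement

section Algebra

variable {ι V : Type*} [AddCommGroup V] [Module ℝ V]

/-- The `i`-th hyperplane. -/
def hyperplane (A : CentralArrangement ι V) (i : ι) : Submodule ℝ V :=
  LinearMap.ker (A.form i)

/-- The open half-space on the positive side of the `i`-th hyperplane. -/
def posSide (A : CentralArrangement ι V) (i : ι) : Set V := {x | 0 < A.form i x}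

/-- The complement of the union of the hyperplanes. -/
def complement (A : CentralArrangement ι V) : Set V := {x | ∀ i, x ∉ A.hyperplane i}

/-- The hyperplanes of the arrangement are pairwise distinct. -/
def IsDistinct (A : CentralArrangement ι V) : Prop := Function.Injective A.hyperplane

/-- Central simplicity (linear general position): for `k ≤ dim V`, any `k` of the hyperplanes
intersect in a subspace of dimension `dim V - k`. -/
def IsCentrallySimple (A : CentralArrangement ι V) : Prop :=
  ∀ s : Finset ι, s.card ≤ Module.finrank ℝ V →
    Module.finrank ℝ (⨅ j ∈ s, A.hyperplane j : Submodule ℝ V) = Module.finrank ℝ V - s.card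

/-- The deletion of the `i`-th hyperplane. -/
def deletion (A : CentralArrangement ι V) (i : ι) : CentralArrangement {j : ι // j ≠ i} V where
  form j := A.form j
  form_ne_zero j := A.form_ne_zero j

theorem domRestrict_ne_zero (A : CentralArrangement ι V) (hA : A.IsDistinct) {i j : ι}
    (hji : j ≠ i) : (A.form j).domRestrict (A.hyperplane i) ≠ 0 := by
  intro h
  have hle : LinearMap.ker (A.form i) ≤ LinearMap.ker (A.form j) := fun x hx => by
    have := LinearMap.congr_fun h ⟨x, hx⟩
    simpa using this
  have hi : IsCoatom (LinearMap.ker (A.form i)) :=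
    LinearMap.isCoatom_ker_of_surjective (LinearMap.surjective (A.form_ne_zero i))
  rcases hi.le_iff.mp hle with h' | h'
  · exact A.form_ne_zero j (LinearMap.ker_eq_top.mp h')
  · exact hji (hA h')

/-- The restriction of an arrangement of distinct hyperplanes to its `i`-th hyperplane `H`: the
arrangement, in the vector space `H`, of the intersections `H' ∩ H` with `H'` one of the other
hyperplanes. -/
def restriction (A : CentralArrangement ι V) (hA : A.IsDistinct) (i : ι) :
    CentralArrangement {j : ι // j ≠ i} (A.hyperplane i) where
  form j := (A.form j).domRestrict (A.hyperplane i)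
  form_ne_zero j := A.domRestrict_ne_zero hA j.2

/-- The hyperplanes of the restriction are the intersections `H' ∩ H`, seen inside `H`. -/
theorem restriction_hyperplane (A : CentralArrangement ι V) (hA : A.IsDistinct) (i : ι)
    (j : {j : ι // j ≠ i}) :
    ((A.restriction hA i).hyperplane j).map (A.hyperplane i).subtype =
      A.hyperplane j ⊓ A.hyperplane i := by
  ext x
  constructor
  · rintro ⟨y, hy, rfl⟩
    exact ⟨hy, y.2⟩
  · rintro ⟨h1, h2⟩
    exact ⟨⟨x, h2⟩, h1, rfl⟩

end Algebra

section Topes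

variable {ι V : Type*} [NormedAddCommGroup V] [NormedSpace ℝ V]

/-- The topes: the connected components of the complement of the union of the hyperplanes. -/
def topes (A : CentralArrangement ι V) : Set (Set V) :=
  {T | ∃ x ∈ A.complement, T = connectedComponentIn A.complement x}

theorem topes_finite [Finite ι] (A : CentralArrangement ι V) : A.topes.Finite := by
  classical
  -- two points of the complement with the same signs lie in the same component
  have key : ∀ x ∈ A.complement, ∀ y ∈ A.complement,
      {i | 0 < A.form i x} = {i | 0 < A.form i y} →
      connectedComponentIn A.complement x = connectedComponentIn A.complement y := by
    intro x hx y hy hxy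
    have hseg : segment ℝ x y ⊆ A.complement := by
      rintro z ⟨a, b, ha, hb, hab, rfl⟩ i hi
      have hx' : A.form i x ≠ 0 := hx i
      have hy' : A.form i y ≠ 0 := hy i
      have hiff : 0 < A.form i x ↔ 0 < A.form i y := by
        have := Set.ext_iff.mp hxy i
        simpa using this
      have h0 : a * A.form i x + b * A.form i y = 0 := by
        have : A.form i (a • x + b • y) = 0 := hi
        simpa using this
      rcases lt_or_gt_of_ne hx' with h1 | h1
      · have h2 : A.form i y < 0 :=
          lt_of_le_of_ne (not_lt.mp fun h => absurd (hiff.mpr h) (not_lt.mpr h1.le)) hy'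
        rcases ha.eq_or_lt with rfl | ha'
        · have : b = 1 := by linarith
          subst this
          linarith
        · nlinarith [mul_neg_of_pos_of_neg ha' h1, mul_nonneg hb (neg_pos.mpr h2).le]
      · have h2 := hiff.mp h1
        rcases ha.eq_or_lt with rfl | ha'
        · have : b = 1 := by linarith
          subst this
          linarith
        · nlinarith [mul_pos ha' h1, mul_nonneg hb h2.le]
    have := (convex_segment (𝕜 := ℝ) x y).isPreconnected.subset_connectedComponentIn
      (left_mem_segment ℝ x y) hseg
    exact connectedComponentIn_eq (this (right_mem_segment ℝ x y))
  let g : Set ι → Set V := fun s =>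
    if h : ∃ x ∈ A.complement, {i | 0 < A.form i x} = s then
      connectedComponentIn A.complement h.choose else ∅
  refine (Set.finite_range g).subset ?_
  rintro T ⟨x, hx, rfl⟩
  have h : ∃ z ∈ A.complement, {i | 0 < A.form i z} = {i | 0 < A.form i x} := ⟨x, hx, rfl⟩
  refine ⟨{i | 0 < A.form i x}, ?_⟩
  simp only [g, dif_pos h]
  exact key _ h.choose_spec.1 _ hx h.choose_spec.2

/-- The number of hyperplanes whose positive side contains `T`. -/
noncomputable def positiveCount (A : CentralArrangement ι V) (T : Set V) : ℕ :=
  {i | T ⊆ A.posSide i}.ncard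

/-- The signed odd-even invariant. -/
noncomputable def signedOddEvenInvariant [Finite ι] (A : CentralArrangement ι V) : ℤ :=
  ∑ T ∈ A.topes_finite.toFinset, (-1 : ℤ) ^ A.positiveCount T

/-- The odd-even invariant. -/
noncomputable def oddEvenInvariant [Finite ι] (A : CentralArrangement ι V) : ℤ :=
  |A.signedOddEvenInvariant|

/-- The tope graph: two distinct topes are adjacent if the intersection of their closures is a
facet of (the closure of) each. -/
def topeGraph (A : CentralArrangement ι V) : SimpleGraph A.topes where
  Adj S T := S ≠ T ∧
    IsPolyhedronFacet (closure (S : Set V)) (closure (S : Set V) ∩ closure (T : Set V)) ∧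
    IsPolyhedronFacet (closure (T : Set V)) (closure (S : Set V) ∩ closure (T : Set V))
  symm := ⟨fun S T h => ⟨h.1.symm, by rw [Set.inter_comm]; exact h.2.2,
    by rw [Set.inter_comm]; exact h.2.1⟩⟩
  loopless := ⟨fun _ h => h.1 rfl⟩

end Topes

end CentralArrangement

/-
Colour a tope of the deletion of `H` by the parity of its positive hyperplanes, and colour a tope of
the whole arrangement like the tope of the deletion that contains it. An edge of the tope graph
crosses exactly one hyperplane: if that is `H`, then both ends lie in one tope of the deletion,
and otherwise they lie on the same side of `H` and have opposite colours. Let `X` and `Y` be the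
topes of the deletion meeting the positive and the negative side of `H`, so that `X ∪ Y` consists
of all of them and `X ∩ Y` of those cut by `H`, which correspond to the topes of the restriction.
Given a perfect matching, let `Z ⊆ X ∩ Y` be the topes of the deletion containing a matching edge
that crosses `H`. On either side of `H` the other edges cancel, so `X` and `Y` have the same signed
sum as `Z`. By inclusion-exclusion the signed sum over `X ∪ Y` is that over `Z` minus that over
`(X ∩ Y) \ Z`, and is at most `|X ∩ Y|` in absolute value.
-/

open Function Topology
open scoped symmDiff

section Combinatorics

theorem abs_sum_union_le_card_inter {β R : Type*} [DecidableEq β] [CommRing R] [LinearOrder R]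
    [IsStrictOrderedRing R] {X Y Z : Finset β} {w : β → R} (hw : ∀ t, |w t| ≤ 1)
    (hZ : Z ⊆ X ∩ Y) (hX : ∑ t ∈ X, w t = ∑ t ∈ Z, w t) (hY : ∑ t ∈ Y, w t = ∑ t ∈ Z, w t) :
    |∑ t ∈ X ∪ Y, w t| ≤ (X ∩ Y).card := by
  have abs_sum_le_card (s : Finset β) : |∑ t ∈ s, w t| ≤ s.card :=
    (s.abs_sum_le_sum_abs w).trans ((Finset.sum_le_sum fun t _ => hw t).trans (by simp))
  have union_eq : ∑ t ∈ X ∪ Y, w t = ∑ t ∈ Z, w t - ∑ t ∈ (X ∩ Y) \ Z, w t := by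
    linear_combination Finset.sum_union_inter (s₁ := X) (s₂ := Y) (f := w) + hX + hY
      + Finset.sum_sdiff (f := w) hZ
  calc |∑ t ∈ X ∪ Y, w t|
      ≤ |∑ t ∈ Z, w t| + |∑ t ∈ (X ∩ Y) \ Z, w t| := union_eq ▸ abs_sub _ _
    _ ≤ Z.card + ((X ∩ Y) \ Z).card := add_le_add (abs_sum_le_card _) (abs_sum_le_card _)
    _ = (X ∩ Y).card := by rw [add_comm]; exact_mod_cast Finset.card_sdiff_add_card_eq_card hZ

theorem sum_eq_sum_filter_of_involutive {α R : Type*} [AddCommGroup R] {f : α → α}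
    (hf : Involutive f) (hne : ∀ a, f a ≠ a) {s : Finset α} {p : α → Prop} [DecidablePred p]
    {w : α → R} (h : ∀ a ∈ s, ¬ p a → f a ∈ s ∧ ¬ p (f a) ∧ w (f a) = -w a) :
    ∑ a ∈ s, w a = ∑ a ∈ s with p a, w a := by
  have cancel : ∑ a ∈ s with ¬ p a, w a = 0 := by
    refine Finset.sum_involution (fun a _ => f a) (fun a ha => ?_) (fun a _ _ => hne a)
      (fun a ha => ?_) (fun a _ => hf a)
    all_goals
      obtain ⟨has, hap⟩ := Finset.mem_filter.mp ha
      obtain ⟨hfs, hfp, hw⟩ := h a has hap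
    · rw [hw, add_neg_cancel]
    · exact Finset.mem_filter.mpr ⟨hfs, hfp⟩
  rw [← Finset.sum_filter_add_sum_filter_not s p, cancel, add_zero]

theorem neg_one_pow_ncard_of_symmDiff_eq_singleton {κ R : Type*} [Finite κ] [Ring R] {s t : Set κ}
    {j : κ} (h : s ∆ t = {j}) : (-1 : R) ^ t.ncard = -(-1) ^ s.ncard := by
  obtain rfl : t = s ∆ {j} := by rw [← h, symmDiff_symmDiff_cancel_left]
  by_cases hj : j ∈ s
  · have : s ∆ {j} = s \ {j} := symmDiff_of_ge (Set.singleton_subset_iff.mpr hj)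
    rw [this, ← Set.ncard_sdiff_singleton_add_one hj, pow_succ]
    simp
  · have : s ∆ {j} = insert j s := by
      rw [(Set.disjoint_singleton_right.mpr hj).symmDiff_eq_sup]
      exact Set.union_singleton
    rw [this, Set.ncard_insert_of_notMem hj, pow_succ]
    simp

theorem exists_involutive_of_isPerfectMatching {V : Type*} {G : SimpleGraph V} {M : G.Subgraph}
    (hM : M.IsPerfectMatching) : ∃ f : V → V, Involutive f ∧ ∀ v, G.Adj v (f v) := by
  choose f hf hunique using SimpleGraph.Subgraph.isPerfectMatching_iff.mp hM
  exact ⟨f, fun v => (hunique (f v) v (hf v).symm).symm, fun v => (hf v).adj_sub⟩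

variable {ι : Type*}

/-- The set `s` with the coordinate `i` forgotten, as for a punctured code. On sets of positive
hyperplanes this is the effect of deleting, or of restricting to, the `i`-th hyperplane. -/
def puncture (i : ι) (s : Set ι) : Set {j : ι // j ≠ i} := Subtype.val ⁻¹' s

theorem eq_of_puncture_eq {i : ι} {s t : Set ι} (h : puncture i s = puncture i t)
    (hi : i ∈ s ↔ i ∈ t) : s = t := by
  ext j
  by_cases hj : j = i
  · rwa [hj]
  · exact Set.ext_iff.mp h ⟨j, hj⟩

theorem puncture_eq_of_symmDiff_eq_singleton {i : ι} {s t : Set ι} (h : s ∆ t = {i}) :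
    puncture i s = puncture i t := by
  refine symmDiff_eq_bot.mp ?_
  change Subtype.val ⁻¹' (s ∆ t) = ∅
  rw [h]
  exact Set.eq_empty_of_forall_notMem fun j => j.2

theorem puncture_symmDiff_eq_singleton {i j : ι} (hj : j ≠ i) {s t : Set ι} (h : s ∆ t = {j}) :
    puncture i s ∆ puncture i t = {⟨j, hj⟩} := by
  change Subtype.val ⁻¹' (s ∆ t) = _
  rw [h]
  ext k
  exact (Subtype.ext_iff (a1 := k) (a2 := ⟨j, hj⟩)).symm

variable {α : Type*} {S : α → Set ι} {f : α → α}

open Classical in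
theorem sum_image_puncture_eq_sum_crossing [Finite ι] (hS : Injective S) (hf : Involutive f)
    (hadj : ∀ a, ∃ j, S a ∆ S (f a) = {j}) {i : ι} {D : Finset α}
    (hD : ∀ a ∈ D, ∀ b, b ∈ D ↔ (i ∈ S a ↔ i ∈ S b)) :
    ∑ t ∈ D.image fun a => puncture i (S a), (-1 : ℤ) ^ t.ncard =
      ∑ t ∈ {a ∈ D | i ∈ S a ∆ S (f a)}.image fun a => puncture i (S a), (-1 : ℤ) ^ t.ncard := by
  have injOn : Set.InjOn (fun a => puncture i (S a)) D := fun a ha b hb hab =>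
    hS (eq_of_puncture_eq hab ((hD a ha b).mp hb))
  have hne (a : α) : f a ≠ a := fun h => by
    obtain ⟨j, hj⟩ := hadj a
    rw [h, symmDiff_self] at hj
    exact Set.singleton_ne_empty j hj.symm
  rw [Finset.sum_image injOn, Finset.sum_image (injOn.mono (Finset.filter_subset _ D))]
  refine sum_eq_sum_filter_of_involutive hf hne fun a ha hcross => ⟨?_, ?_, ?_⟩
  · rw [hD a ha]
    rw [Set.mem_symmDiff] at hcross
    tauto
  · rwa [hf a, symmDiff_comm]
  · obtain ⟨j, hj⟩ := hadj a
    have hji : j ≠ i := by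
      rintro rfl
      exact hcross (hj ▸ rfl)
    exact neg_one_pow_ncard_of_symmDiff_eq_singleton (puncture_symmDiff_eq_singleton hji hj)

open Classical in
theorem image_puncture_crossing_subset (hf : Involutive f)
    (hadj : ∀ a, ∃ j, S a ∆ S (f a) = {j}) {i : ι} {D E : Finset α}
    (hDE : ∀ a ∈ D, i ∈ S a ∆ S (f a) → f a ∈ E) :
    ({a ∈ D | i ∈ S a ∆ S (f a)}.image fun a => puncture i (S a)) ⊆
      {a ∈ E | i ∈ S a ∆ S (f a)}.image fun a => puncture i (S a) := by
  intro t ht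
  obtain ⟨a, ha, rfl⟩ := Finset.mem_image.mp ht
  obtain ⟨haD, hcross⟩ := Finset.mem_filter.mp ha
  have hfa : f a ∈ {a ∈ E | i ∈ S a ∆ S (f a)} :=
    Finset.mem_filter.mpr ⟨hDE a haD hcross, by rwa [hf a, symmDiff_comm]⟩
  refine Finset.mem_image.mpr ⟨f a, hfa, ?_⟩
  obtain ⟨j, hj⟩ := hadj a
  obtain rfl : i = j := by rwa [hj] at hcross
  exact (puncture_eq_of_symmDiff_eq_singleton hj).symm

theorem abs_finsum_puncture_le_ncard [Finite ι] [Finite α] (hS : Injective S) (hf : Involutive f)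
    (hadj : ∀ a, ∃ j, S a ∆ S (f a) = {j}) (i : ι) :
    |∑ᶠ t ∈ Set.range fun a => puncture i (S a), (-1 : ℤ) ^ t.ncard| ≤
      (((fun a => puncture i (S a)) '' {a | i ∈ S a}) ∩
        ((fun a => puncture i (S a)) '' {a | i ∉ S a})).ncard := by
  classical
  cases nonempty_fintype α
  set res : α → Set {j : ι // j ≠ i} := fun a => puncture i (S a)
  let P : Finset α := {a | i ∈ S a}
  let N : Finset α := {a | i ∉ S a}
  have coe_P : ((P.image res : Finset _) : Set _) = res '' {a | i ∈ S a} := by simp [P]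
  have coe_N : ((N.image res : Finset _) : Set _) = res '' {a | i ∉ S a} := by simp [N]
  have range_eq : Set.range res = ((P.image res ∪ N.image res : Finset _) : Set _) := by
    rw [← Finset.image_union, Finset.filter_union_filter_not_eq, Finset.coe_image, Finset.coe_univ,
      Set.image_univ]
  have crossing_eq : {a ∈ P | i ∈ S a ∆ S (f a)}.image res =
      {a ∈ N | i ∈ S a ∆ S (f a)}.image res := by
    apply Finset.Subset.antisymm <;>
    · refine image_puncture_crossing_subset hf hadj fun a ha hcross => ?_
      simp_all [P, N, Set.mem_symmDiff]
  rw [range_eq, finsum_mem_coe_finset, ← coe_P, ← coe_N, ← Finset.coe_inter,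
    Set.ncard_coe_finset]
  refine abs_sum_union_le_card_inter (fun t => by simp) ?_
    (sum_image_puncture_eq_sum_crossing hS hf hadj fun a ha b => ?_)
    (crossing_eq ▸ sum_image_puncture_eq_sum_crossing hS hf hadj fun a ha b => ?_)
  · refine Finset.subset_inter (Finset.image_subset_image (Finset.filter_subset _ _)) ?_
    exact crossing_eq ▸ Finset.image_subset_image (Finset.filter_subset _ _)
  · simp_all [P]
  · simp_all [N]

end Combinatorics

theorem IsPolyhedronFacet.vectorSpan_eq_ker {V : Type*} [NormedAddCommGroup V] [NormedSpace ℝ V]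
    [FiniteDimensional ℝ V] {P F : Set V} (hF : IsPolyhedronFacet P F) {φ : Module.Dual ℝ V}
    (hφ : φ ≠ 0) (hFφ : F ⊆ LinearMap.ker φ) : vectorSpan ℝ F = LinearMap.ker φ := by
  refine Submodule.eq_of_le_of_finrank_eq ?_ ?_
  · rw [vectorSpan_def, Submodule.span_le]
    rintro _ ⟨x, hx, y, hy, rfl⟩
    exact sub_mem (hFφ hx) (hFφ hy)
  · have := Module.Dual.finrank_ker_add_one_of_ne_zero hφ
    have := hF.2.2
    omega

namespace CentralArrangement

section Chambers

variable {ι V : Type*} [AddCommGroup V] [Module ℝ V] (A : CentralArrangement ι V)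

/-- The open cone of the points lying on the positive side of exactly the hyperplanes in `s`, and
on the negative side of the others. The nonempty chambers are the topes; describing them by sign
conditions makes no reference to a topology. -/
def chamber (s : Set ι) : Set V :=
  {x | (∀ i ∈ s, 0 < A.form i x) ∧ ∀ i ∉ s, A.form i x < 0}

/-- The sign vectors of the topes, a sign vector being encoded by the set of its positive
coordinates. -/
def signSets : Set (Set ι) := {s | (A.chamber s).Nonempty}

/-- The sign vector of a tope `T`, encoded by the set of hyperplanes whose positive side
contains `T`. -/
def positiveSet (T : Set V) : Set ι := {i | T ⊆ A.posSide i}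

variable {A} {i : ι} {s t : Set ι} {x : V}

theorem form_pos_iff_of_mem_chamber (hx : x ∈ A.chamber s) : 0 < A.form i x ↔ i ∈ s :=
  ⟨fun h => by_contra fun hi => h.not_gt (hx.2 i hi), hx.1 i⟩

theorem eq_of_mem_chamber (hs : x ∈ A.chamber s) (ht : x ∈ A.chamber t) : s = t :=
  Set.ext fun _ => (form_pos_iff_of_mem_chamber hs).symm.trans (form_pos_iff_of_mem_chamber ht)

theorem chamber_subset_complement : A.chamber s ⊆ A.complement := fun x hx i hi => by
  have hzero : A.form i x = 0 := hi
  by_cases his : i ∈ s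
  · exact (hx.1 i his).ne' hzero
  · exact (hx.2 i his).ne hzero

theorem mem_chamber_of_mem_complement (hx : x ∈ A.complement) :
    x ∈ A.chamber {i | 0 < A.form i x} :=
  ⟨fun _ hi => hi, fun i hi => (not_lt.mp hi).lt_of_ne (hx i)⟩

theorem convex_chamber : Convex ℝ (A.chamber s) := by
  have : A.chamber s = (⋂ i ∈ s, {x | 0 < A.form i x}) ∩ ⋂ i ∈ sᶜ, {x | A.form i x < 0} := by
    ext x
    simp [chamber]
  rw [this]
  exact (convex_iInter₂ fun i _ => convex_halfSpace_gt (A.form i).isLinear 0).inter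
    (convex_iInter₂ fun i _ => convex_halfSpace_lt (A.form i).isLinear 0)

theorem positiveSet_chamber (hs : s ∈ A.signSets) : A.positiveSet (A.chamber s) = s := by
  obtain ⟨x, hx⟩ := hs
  exact Set.ext fun i => ⟨fun h => (form_pos_iff_of_mem_chamber hx).mp (h hx),
    fun hi _ hy => hy.1 i hi⟩

theorem exists_pos_add_smul_mem_chamber [Finite ι] (hx : x ∈ A.chamber s) (v : V) :
    ∃ ε > (0 : ℝ), x + ε • v ∈ A.chamber s := by
  have tendsto_form (i : ι) :
      Filter.Tendsto (fun ε : ℝ => A.form i (x + ε • v)) (𝓝[>] 0) (𝓝 (A.form i x)) := by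
    have : Continuous fun ε : ℝ => A.form i x + ε * A.form i v := by fun_prop
    simpa using (this.tendsto 0).mono_left nhdsWithin_le_nhds
  have eventually_mem : ∀ᶠ ε : ℝ in 𝓝[>] 0, x + ε • v ∈ A.chamber s := by
    refine (Filter.eventually_all.mpr fun i => ?_).and (Filter.eventually_all.mpr fun i => ?_)
    · exact Filter.eventually_imp_distrib_left.mpr fun hi =>
        (tendsto_form i).eventually_const_lt (hx.1 i hi)
    · exact Filter.eventually_imp_distrib_left.mpr fun hi =>
        (tendsto_form i).eventually_lt_const (hx.2 i hi)
  obtain ⟨ε, hmem, hε⟩ := (eventually_mem.and self_mem_nhdsWithin).exists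
  exact ⟨ε, hε, hmem⟩

theorem chamber_subset_chamber_deletion :
    A.chamber s ⊆ (A.deletion i).chamber (puncture i s) :=
  fun _ hx => ⟨fun j => hx.1 j, fun j => hx.2 j⟩

theorem exists_mem_chamber_of_mem_chamber_deletion {t : Set {j : ι // j ≠ i}}
    (hx : x ∈ (A.deletion i).chamber t) (hi : A.form i x ≠ 0) :
    ∃ s, x ∈ A.chamber s ∧ puncture i s = t := by
  have hxA : x ∈ A.complement := fun j hj => by
    by_cases hji : j = i
    · exact hi (hji ▸ hj)
    · exact chamber_subset_complement hx ⟨j, hji⟩ hj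
  have hxs := mem_chamber_of_mem_complement hxA
  exact ⟨_, hxs, eq_of_mem_chamber (chamber_subset_chamber_deletion hxs) hx⟩

theorem mem_image_puncture_pos {t : Set {j : ι // j ≠ i}} :
    t ∈ puncture i '' {s ∈ A.signSets | i ∈ s} ↔
      ∃ x ∈ (A.deletion i).chamber t, 0 < A.form i x := by
  constructor
  · rintro ⟨s, ⟨⟨x, hx⟩, his⟩, rfl⟩
    exact ⟨x, chamber_subset_chamber_deletion hx, hx.1 i his⟩
  · rintro ⟨x, hx, hi⟩
    obtain ⟨s, hs, rfl⟩ := exists_mem_chamber_of_mem_chamber_deletion hx hi.ne'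
    exact ⟨s, ⟨⟨x, hs⟩, (form_pos_iff_of_mem_chamber hs).mp hi⟩, rfl⟩

theorem mem_image_puncture_neg {t : Set {j : ι // j ≠ i}} :
    t ∈ puncture i '' {s ∈ A.signSets | i ∉ s} ↔
      ∃ x ∈ (A.deletion i).chamber t, A.form i x < 0 := by
  constructor
  · rintro ⟨s, ⟨⟨x, hx⟩, his⟩, rfl⟩
    exact ⟨x, chamber_subset_chamber_deletion hx, hx.2 i his⟩
  · rintro ⟨x, hx, hi⟩
    obtain ⟨s, hs, rfl⟩ := exists_mem_chamber_of_mem_chamber_deletion hx hi.ne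
    exact ⟨s, ⟨⟨x, hs⟩, fun his => hi.not_gt (hs.1 i his)⟩, rfl⟩

theorem signSets_deletion [Finite ι] (A : CentralArrangement ι V) (i : ι) :
    (A.deletion i).signSets = puncture i '' A.signSets := by
  ext t
  constructor
  · rintro ⟨x, hx⟩
    obtain ⟨y, hy, hyi⟩ : ∃ y ∈ (A.deletion i).chamber t, A.form i y ≠ 0 := by
      by_cases hxi : A.form i x = 0
      · obtain ⟨v, hv⟩ := LinearMap.surjective (A.form_ne_zero i) 1
        obtain ⟨ε, hε, hmem⟩ := exists_pos_add_smul_mem_chamber hx v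
        exact ⟨_, hmem, by simp [hxi, hv, hε.ne']⟩
      · exact ⟨x, hx, hxi⟩
    obtain ⟨s, hs, rfl⟩ := exists_mem_chamber_of_mem_chamber_deletion hy hyi
    exact ⟨s, ⟨y, hs⟩, rfl⟩
  · rintro ⟨s, ⟨x, hx⟩, rfl⟩
    exact ⟨x, chamber_subset_chamber_deletion hx⟩

theorem mem_signSets_restriction_iff_exists_mem_hyperplane (hA : A.IsDistinct)
    {t : Set {j : ι // j ≠ i}} :
    t ∈ (A.restriction hA i).signSets ↔ ∃ x ∈ (A.deletion i).chamber t, A.form i x = 0 :=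
  ⟨fun ⟨x, hx⟩ => ⟨x, hx, x.2⟩, fun ⟨x, hx, hxi⟩ => ⟨⟨x, hxi⟩, hx⟩⟩

theorem signSets_restriction [Finite ι] (hA : A.IsDistinct) (i : ι) :
    (A.restriction hA i).signSets =
      puncture i '' {s ∈ A.signSets | i ∈ s} ∩ puncture i '' {s ∈ A.signSets | i ∉ s} := by
  ext t
  rw [Set.mem_inter_iff, mem_image_puncture_pos, mem_image_puncture_neg,
    mem_signSets_restriction_iff_exists_mem_hyperplane]
  constructor
  · rintro ⟨x, hx, hxi⟩
    obtain ⟨v, hv⟩ := LinearMap.surjective (A.form_ne_zero i) 1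
    obtain ⟨ε, hε, hpos⟩ := exists_pos_add_smul_mem_chamber hx v
    obtain ⟨δ, hδ, hneg⟩ := exists_pos_add_smul_mem_chamber hx (-v)
    exact ⟨⟨_, hpos, by simpa [hxi, hv] using hε⟩, ⟨_, hneg, by simpa [hxi, hv] using hδ⟩⟩
  · rintro ⟨⟨x, hx, hxi⟩, ⟨y, hy, hyi⟩⟩
    have hconv : (A.form i '' (A.deletion i).chamber t).OrdConnected :=
      (convex_chamber.linear_image (A.form i)).ordConnected
    exact hconv.out ⟨y, hy, rfl⟩ ⟨x, hx, rfl⟩ ⟨hyi.le, hxi.le⟩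

end Chambers

section TopeSigns

variable {ι V : Type*} [NormedAddCommGroup V] [NormedSpace ℝ V] [FiniteDimensional ℝ V]
  {A : CentralArrangement ι V}

theorem connectedComponentIn_complement {s : Set ι} {x : V} (hx : x ∈ A.chamber s) :
    connectedComponentIn A.complement x = A.chamber s := by
  have hxA : x ∈ A.complement := chamber_subset_complement hx
  have hpos (i : ι) : IsOpen {y | 0 < A.form i y} :=
    isOpen_lt continuous_const (A.form i).continuous_of_finiteDimensional
  have hneg (i : ι) : IsOpen {y | A.form i y < 0} :=
    isOpen_lt (A.form i).continuous_of_finiteDimensional continuous_const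
  have hdisj (i : ι) : Disjoint {y | 0 < A.form i y} {y | A.form i y < 0} :=
    Set.disjoint_left.mpr fun y (hy : 0 < A.form i y) => hy.not_gt
  have hcover (i : ι) :
      connectedComponentIn A.complement x ⊆ {y | 0 < A.form i y} ∪ {y | A.form i y < 0} :=
    fun y hy => (lt_or_gt_of_ne (connectedComponentIn_subset _ _ hy i)).symm
  apply Set.Subset.antisymm
  · refine fun y hy => ⟨fun i hi => ?_, fun i hi => ?_⟩
    · exact isPreconnected_connectedComponentIn.subset_left_of_subset_union (hpos i) (hneg i)
        (hdisj i) (hcover i) ⟨x, mem_connectedComponentIn hxA, hx.1 i hi⟩ hy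
    · exact isPreconnected_connectedComponentIn.subset_right_of_subset_union (hpos i) (hneg i)
        (hdisj i) (hcover i) ⟨x, mem_connectedComponentIn hxA, hx.2 i hi⟩ hy
  · exact convex_chamber.isPreconnected.subset_connectedComponentIn hx chamber_subset_complement

theorem topes_eq_image_chamber (A : CentralArrangement ι V) :
    A.topes = A.chamber '' A.signSets := by
  ext T
  constructor
  · rintro ⟨x, hx, rfl⟩
    have hxs := mem_chamber_of_mem_complement hx
    exact ⟨_, ⟨x, hxs⟩, (connectedComponentIn_complement hxs).symm⟩
  · rintro ⟨s, ⟨x, hx⟩, rfl⟩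
    exact ⟨x, chamber_subset_complement hx, (connectedComponentIn_complement hx).symm⟩

theorem bijOn_positiveSet (A : CentralArrangement ι V) :
    Set.BijOn A.positiveSet A.topes A.signSets := by
  rw [topes_eq_image_chamber]
  refine Set.InvOn.bijOn (f' := A.chamber) ⟨?_, fun s => positiveSet_chamber⟩ ?_
    (Set.mapsTo_image _ _)
  · rintro _ ⟨s, hs, rfl⟩
    rw [positiveSet_chamber hs]
  · rintro _ ⟨s, hs, rfl⟩
    rwa [positiveSet_chamber hs]

theorem chamber_positiveSet {T : Set V} (hT : T ∈ A.topes) : A.chamber (A.positiveSet T) = T := by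
  obtain ⟨s, hs, rfl⟩ := A.topes_eq_image_chamber ▸ hT
  rw [positiveSet_chamber hs]

theorem ncard_signSets (A : CentralArrangement ι V) : A.signSets.ncard = A.topes.ncard := by
  rw [← A.bijOn_positiveSet.image_eq, A.bijOn_positiveSet.injOn.ncard_image]

theorem signedOddEvenInvariant_eq_finsum [Finite ι] (A : CentralArrangement ι V) :
    A.signedOddEvenInvariant = ∑ᶠ s ∈ A.signSets, (-1 : ℤ) ^ s.ncard := by
  rw [signedOddEvenInvariant, ← finsum_mem_eq_finite_toFinset_sum]
  exact finsum_mem_eq_of_bijOn A.positiveSet A.bijOn_positiveSet fun _ _ => rfl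

theorem closure_chamber_subset (s : Set ι) :
    closure (A.chamber s) ⊆ {x | (∀ i ∈ s, 0 ≤ A.form i x) ∧ ∀ i ∉ s, A.form i x ≤ 0} := by
  have hcont (i : ι) : Continuous (A.form i) := (A.form i).continuous_of_finiteDimensional
  refine closure_minimal (fun x hx => ⟨fun i hi => (hx.1 i hi).le, fun i hi => (hx.2 i hi).le⟩) ?_
  simp only [Set.ofPred_and, Set.ofPred_forall]
  exact (isClosed_biInter fun i _ => isClosed_le continuous_const (hcont i)).inter
    (isClosed_iInter fun i => isClosed_iInter fun _ => isClosed_le (hcont i) continuous_const)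

theorem closure_chamber_inter_subset_hyperplane {s t : Set ι} {i : ι} (hi : i ∈ s ∆ t) :
    closure (A.chamber s) ∩ closure (A.chamber t) ⊆ A.hyperplane i := by
  rintro x ⟨hxs, hxt⟩
  obtain ⟨hs_pos, hs_neg⟩ := closure_chamber_subset s hxs
  obtain ⟨ht_pos, ht_neg⟩ := closure_chamber_subset t hxt
  rcases hi with ⟨his, hit⟩ | ⟨hit, his⟩
  · exact le_antisymm (ht_neg i hit) (hs_pos i his)
  · exact le_antisymm (hs_neg i his) (ht_pos i hit)

theorem exists_symmDiff_positiveSet_eq_singleton (hA : A.IsDistinct) {S T : A.topes}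
    (h : A.topeGraph.Adj S T) : ∃ j, A.positiveSet S ∆ A.positiveSet T = {j} := by
  obtain ⟨hne, hfacet, -⟩ := h
  have span_eq {k : ι} (hk : k ∈ A.positiveSet S ∆ A.positiveSet T) :
      vectorSpan ℝ (closure (S : Set V) ∩ closure (T : Set V)) = A.hyperplane k := by
    refine hfacet.vectorSpan_eq_ker (A.form_ne_zero k) ?_
    have := closure_chamber_inter_subset_hyperplane (A := A) hk
    rwa [chamber_positiveSet S.2, chamber_positiveSet T.2] at this
  rw [Set.exists_eq_singleton_iff_nonempty_subsingleton]
  refine ⟨Set.nonempty_iff_ne_empty.mpr fun hempty => ?_, fun j hj k hk => ?_⟩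
  · exact hne (Subtype.ext (A.bijOn_positiveSet.injOn S.2 T.2 (symmDiff_eq_bot.mp hempty)))
  · exact hA ((span_eq hj).symm.trans (span_eq hk))

theorem oddEvenInvariant_deletion_le [Finite ι] (hA : A.IsDistinct) (i : ι)
    {M : A.topeGraph.Subgraph} (hM : M.IsPerfectMatching) :
    (A.deletion i).oddEvenInvariant ≤ (A.restriction hA i).topes.ncard := by
  obtain ⟨f, hf, hadj⟩ := exists_involutive_of_isPerfectMatching hM
  have : Finite A.topes := A.topes_finite
  let S : A.topes → Set ι := fun T => A.positiveSet T
  have hS : Injective S := A.bijOn_positiveSet.injOn.injective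
  have range_S : Set.range S = A.signSets := by
    rw [← A.bijOn_positiveSet.image_eq, Set.image_eq_range]
  have image_S (p : Set ι → Prop) :
      (fun T => puncture i (S T)) '' {T | p (S T)} = puncture i '' {s ∈ A.signSets | p s} := by
    rw [← range_S]
    ext t
    simp
  have hle := abs_finsum_puncture_le_ncard hS hf
    (fun T => exists_symmDiff_positiveSet_eq_singleton hA (hadj T)) i
  rwa [Set.range_comp' (puncture i) S, range_S, image_S (i ∈ ·), image_S (i ∉ ·),
    ← signSets_deletion, ← signSets_restriction hA, ← signedOddEvenInvariant_eq_finsum,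
    ncard_signSets] at hle

end TopeSigns

end CentralArrangement

theorem theorem11_general {ι V : Type*} [Finite ι] [NormedAddCommGroup V] [NormedSpace ℝ V]
    [FiniteDimensional ℝ V] (A : CentralArrangement ι V) (hdist : A.IsDistinct) (i : ι)
    (hi : (A.deletion i).oddEvenInvariant > ((A.restriction hdist i).topes.ncard : ℤ)) :
    ¬ ∃ M : A.topeGraph.Subgraph, M.IsPerfectMatching :=
  fun ⟨_, hM⟩ => hi.not_ge (CentralArrangement.oddEvenInvariant_deletion_le hdist i hM)

theorem theorem11 {n d : ℕ} (A : CentralArrangement (Fin n) (EuclideanSpace ℝ (Fin d)))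
    (hdist : A.IsDistinct) (hsimple : A.IsCentrallySimple) (i : Fin n)
    (hi : (A.deletion i).oddEvenInvariant > 2 * ((A.restriction hdist i).topes.ncard : ℤ)) :
    ¬ ∃ M : A.topeGraph.Subgraph, M.IsPerfectMatching :=
  theorem11_general A hdist i (by omega)
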